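/- Write $[\,\cdot\,]$ for convex hull and $\mathcal V(\cdot)$ for the vertex set. Let $m>1$, and let $P$ be a neighbourly $2m$-polytope in a $2m$-dimensional real space (every $m$ vertices of $P$ span a proper face) with at least $2m+3$ vertices. A $k$-face $U$ of $P$ is *universal* if $[S,U]$ is a face of $P$ for all $S\subset\mathcal V(P)$ with $|S|\le\lfloor(2m-k-1)/2\rfloor$. Let $x_1,\dots,x_m,y_1,\dots,y_m$ be distinct vertices of $P$ such that $\Phi_1=[x_1,y_1]$, $\Phi_j=[\Phi_{j-1},x_j,y_j]$ $(2\le j\le m)$ form a universal tower, i.e. $\Phi_j$ is a universal $(2j-1)$-face of $P$ for $1\le j\le m$. A point $z\notin\operatorname{aff}F$ is *beyond* a facet $F$ of a polytope if $\operatorname{aff}F$ separates $z$ from the polytope, and *beneath* $F$ otherwise. For a tower $\mathcal T=\{T_1\subset\dots\subset T_r\}$ of faces of a polytope let $\mathscr F_j$ be the set of facets containing $T_j$ for $1\le j\le r$, $\mathscr F_j=\emptyset$ for $j>r$, and $\mathcal C(\mathcal T)=(\mathscr F_1\setminus\mathscr F_2)\cup(\mathscr F_3\setminus\mathscr F_4)\cup\cdots$.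 A point is *exactly beyond* $\mathcal C(\mathcal T)$ if it is beyond every facet in $\mathcal C(\mathcal T)$ and beneath every other facet; a vertex sewn through $\mathcal T$ is such a point. Let $\bar x$ be exactly beyond $\mathcal C(\{\Phi_1,\dots,\Phi_m\})$ with respect to $P$. Let $1\le i\le m$ and let $P/\Phi_i$ be a quotient polytope, i.e. a $(2m-2i)$-polytope in a $(2m-2i)$-dimensional real space together with an isomorphism $G\mapsto G^*$ from the lattice of faces of $P$ containing $\Phi_i$ onto its face lattice; for $v\in\mathcal V(P)\setminus\mathcal V(\Phi_i)$, write $v^*$ for the vertex corresponding to $[\Phi_i,v]$. Let $\bar y^*$ be exactly beyond $\mathcal C(\{\Phi_{i+1}^*,\dots,\Phi_m^*\})$ with respect to $P/\Phi_i$. Let $F^*=[v_1^*,\dots,v_{2m-2i}^*]$ be a facet of $P/\Phi_i$, where $v_1,\dots,v_{2m-2i}\in\mathcal V(P)\setminus\mathcal V(\Phi_i)$, and put $F=[v_1,\dots,v_{2m-2i}]$. Then $[\Phi_i,F]$ is a facet of $P$, and $\bar y^*$ is beneath (respectively beyond) $F^*$ if and only if either 1. $\bar x$ is beneath (respectively beyond)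 $[\Phi_i,F]$ and $i$ is even, or 2. $\bar x$ is beyond (respectively beneath) $[\Phi_i,F]$ and $i$ is odd. -/

import Mathlib

namespace Sewing

section

variable {E E' : Type*} [NormedAddCommGroup E] [NormedSpace ℝ E]
  [NormedAddCommGroup E'] [NormedSpace ℝ E']

/-- `P` is a `d`-polytope, full-dimensional in its ambient `d`-dimensional space `E`. -/
structure IsPolytope (d : ℕ) (P : Set E) : Prop where
  finrank_eq : Module.finrank ℝ E = d
  exists_finset : ∃ s : Finset E, P = convexHull ℝ (s : Set E)
  span_eq_top : affineSpan ℝ P = ⊤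

/-- The vertices of `P`. -/
abbrev vertices (P : Set E) : Set E := P.extremePoints ℝ

/-- Faces of a convex set, including the empty face and `P` itself. -/
def IsFace (P F : Set E) : Prop := IsExtreme ℝ P F ∧ Convex ℝ F

/-- A facet is a maximal proper face. -/
def IsFacet (P F : Set E) : Prop :=
  IsFace P F ∧ F ≠ P ∧ ∀ G, IsFace P G → F ⊆ G → G ≠ P → G = F

/-- Every `k` vertices of `P` are the vertices of a proper face of `P`. -/
def IsKNeighbourly (k : ℕ) (P : Set E) : Prop :=
  ∀ S : Finset E, (S : Set E) ⊆ vertices P → S.card = k →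
    IsFace P (convexHull ℝ (S : Set E)) ∧ convexHull ℝ (S : Set E) ≠ P

/-- A neighbourly `d`-polytope. -/
def IsNeighbourly (d : ℕ) (P : Set E) : Prop :=
  IsPolytope d P ∧ IsKNeighbourly (d / 2) P

/-- `U` is a universal `k`-face of the `d`-polytope `P` (used for `k < d`). -/
structure IsUniversalFace (d k : ℕ) (P U : Set E) : Prop where
  isFace : IsFace P U
  nonempty : U.Nonempty
  dim_eq : Module.finrank ℝ (vectorSpan ℝ U) = k
  universal : ∀ S : Finset E, (S : Set E) ⊆ vertices P → S.card ≤ (d - k - 1) / 2 →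
    IsFace P (convexHull ℝ ((S : Set E) ∪ U))

/-- `Φ_0 = ∅` and `Φ_j = [Φ_{j-1}, x_j, y_j]`. -/
def tower (x y : ℕ → E) : ℕ → Set E
  | 0 => ∅
  | n + 1 => convexHull ℝ (tower x y n ∪ {x (n + 1), y (n + 1)})

/-- The vertices `x_1, …, x_m, y_1, …, y_m` span a universal tower `Φ_1 ⊂ ⋯ ⊂ Φ_m`
in the `2m`-polytope `P`. -/
structure IsUniversalTower (m : ℕ) (P : Set E) (x y : ℕ → E) : Prop where
  x_mem : ∀ j ∈ Set.Icc 1 m, x j ∈ vertices P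
  y_mem : ∀ j ∈ Set.Icc 1 m, y j ∈ vertices P
  x_inj : Set.InjOn x (Set.Icc 1 m)
  y_inj : Set.InjOn y (Set.Icc 1 m)
  x_ne_y : ∀ j ∈ Set.Icc 1 m, ∀ k ∈ Set.Icc 1 m, x j ≠ y k
  universal : ∀ j ∈ Set.Icc 1 m, IsUniversalFace (2 * m) (2 * j - 1) P (tower x y j)

/-- For a chain of faces `T 1, …, T m` of `P`: the set of facets that contain `T j`; it is the set
of all facets if `j = 0`, and empty if `j > m`. -/
def facetsThrough (P : Set E) (m : ℕ) (T : ℕ → Set E) (j : ℕ) : Set (Set E) :=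
  {F | IsFacet P F ∧ j ≤ m ∧ (j = 0 ∨ T j ⊆ F)}

/-- `(F_1 \ F_2) ∪ (F_3 \ F_4) ∪ ⋯`, where `F_j` is the set of facets through `T j`. -/
def towerFacets (P : Set E) (m : ℕ) (T : ℕ → Set E) : Set (Set E) :=
  ⋃ j ∈ {j : ℕ | Odd j}, facetsThrough P m T j \ facetsThrough P m T (j + 1)

/-- The flat `aff F` separates `P` and `z`. -/
def Separates (P F : Set E) (z : E) : Prop :=
  ∀ p ∈ P, (affineSpan ℝ F).WOppSide z p

/-- `z` is beyond the facet `F` of `P`. -/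
def Beyond (P F : Set E) (z : E) : Prop :=
  z ∉ affineSpan ℝ F ∧ Separates P F z

/-- `z` is beneath the facet `F` of `P`. -/
def Beneath (P F : Set E) (z : E) : Prop :=
  z ∉ affineSpan ℝ F ∧ ¬ Separates P F z

/-- `z` is beyond every facet of `P` in `C` and beneath every other facet of `P`. -/
def ExactlyBeyond (P : Set E) (C : Set (Set E)) (z : E) : Prop :=
  ∀ F, IsFacet P F → (F ∈ C → Beyond P F z) ∧ (F ∉ C → Beneath P F z)

/-- The faces of `P` that contain `U`, ordered by inclusion. -/
abbrev FacesAbove (P U : Set E) : Type _ := {G : Set E // IsFace P G ∧ U ⊆ G}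

/-- The faces of `Q`, ordered by inclusion. -/
abbrev Faces (Q : Set E') : Type _ := {G : Set E' // IsFace Q G}

/-- A realization of the quotient polytope `P / U` by a polytope `Q`: an isomorphism from the
lattice of faces of `P` that contain `U` to the face lattice of `Q`. -/
abbrev QuotientIso (P U : Set E) (Q : Set E') : Type _ := FacesAbove P U ≃o Faces Q

/-- The face `G*` of `Q = P / U` that corresponds to the face `G ⊇ U` of `P`
(and the empty set if `G` is not such a face). -/
def starFace {P U : Set E} {Q : Set E'} (e : QuotientIso P U Q) (G : Set E) : Set E' :=
  {z | ∃ h : IsFace P G ∧ U ⊆ G, z ∈ (e ⟨G, h⟩ : Set E')}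

end

end Sewing

open Sewing

/-! A facet containing `Φ_i` contains exactly `Φ_1, …, Φ_J` for some `J ≥ i`. Among the differences
of consecutive facet sets it lies only in the `J`-th, so the sewn point is beyond it exactly when
`J` is odd (`mem_towerFacets_iff_odd`). The corresponding facet of `P / Φ_i` contains exactly the
first `J - i` members of the quotient tower, so there the parity of `J - i` decides: the sides agree
for even `i` and are swapped for odd `i`. It remains to identify the facet over `F*` as `[Φ_i, F]`
(`isFacet_symm`, `symm_eq_convexHull`); universality makes each `[Φ_i, w]` a face, so that vertices
can be compared through the isomorphism. -/

namespace Sewing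

variable {E E' : Type*} [NormedAddCommGroup E] [NormedSpace ℝ E]
  [NormedAddCommGroup E'] [NormedSpace ℝ E']

/-- An extreme subset of the convex hull of `s` lies in the hull of the points of `s` it contains. -/
theorem subset_convexHull_inter_of_isExtreme {s A : Set E}
    (hA : IsExtreme ℝ (convexHull ℝ s) A) : A ⊆ convexHull ℝ (s ∩ A) := by
  classical
  intro z hz
  obtain ⟨ι, t, w, p, hw, hsum, hp, rfl⟩ := mem_convexHull_iff_exists_fintype.1 (hA.1 hz)
  -- If `w k < 1`, then `z` is strictly between `p k` and the centre of mass of the other points, so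
  -- extremality applies; otherwise `z = p k`.
  have key : ∀ k, w k ≠ 0 → p k ∈ A := by
    intro k hk
    have hk0 : 0 < w k := lt_of_le_of_ne (hw k) (Ne.symm hk)
    have hsplit := Finset.add_sum_erase Finset.univ w (Finset.mem_univ k)
    have hsplit' := Finset.add_sum_erase Finset.univ (fun l => w l • p l) (Finset.mem_univ k)
    have hrest : ∀ l ∈ Finset.univ.erase k, 0 ≤ w l := fun l _ => hw l
    rcases (Finset.sum_nonneg hrest).eq_or_lt with h0 | hpos
    · have hz0 := (Finset.sum_eq_zero_iff_of_nonneg hrest).1 h0.symm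
      have h1 : w k = 1 := by linarith
      have h2 : ∑ l ∈ Finset.univ.erase k, w l • p l = 0 :=
        Finset.sum_eq_zero fun l hl => by rw [hz0 l hl, zero_smul]
      rw [← hsplit', h2, h1, one_smul, add_zero] at hz
      exact hz
    · refine hA.2 (subset_convexHull ℝ s (hp k))
        ((convex_convexHull ℝ s).centerMass_mem hrest hpos
          fun l _ => subset_convexHull ℝ s (hp l)) hz
        ⟨w k, ∑ l ∈ Finset.univ.erase k, w l, hk0, hpos, by linarith, ?_⟩
      rw [Finset.centerMass, smul_smul, mul_inv_cancel₀ hpos.ne', one_smul]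
      exact hsplit'
  rw [← Finset.sum_filter_of_ne (p := fun k => w k ≠ 0)
    (fun k _ h hk => h (by rw [hk, zero_smul]))]
  refine (convex_convexHull ℝ _).sum_mem (fun k _ => hw k) ?_
    fun k hk => subset_convexHull ℝ _ ⟨hp k, key k (Finset.mem_filter.1 hk).2⟩
  rw [Finset.sum_filter_ne_zero, hsum]

theorem IsPolytope.convex {d : ℕ} {P : Set E} (hP : IsPolytope d P) : Convex ℝ P := by
  obtain ⟨s, rfl⟩ := hP.exists_finset
  exact convex_convexHull ℝ _

theorem IsPolytope.convexHull_vertices {d : ℕ} {P : Set E} (hP : IsPolytope d P) :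
    convexHull ℝ (vertices P) = P := by
  obtain ⟨s, rfl⟩ := hP.exists_finset
  have hfin : (vertices (convexHull ℝ (s : Set E))).Finite :=
    s.finite_toSet.subset extremePoints_convexHull_subset
  have h := closure_convexHull_extremePoints
    (s.finite_toSet.isCompact_convexHull (𝕜 := ℝ)) (convex_convexHull ℝ (s : Set E))
  rwa [(hfin.isClosed_convexHull (𝕜 := ℝ)).closure_eq] at h

/-- A face of a polytope is contained in every convex set that contains its vertices. -/
theorem IsFace.subset_of_vertices {d : ℕ} {P G C : Set E} (hP : IsPolytope d P)
    (hG : IsFace P G) (hC : Convex ℝ C) (h : ∀ w ∈ vertices P, w ∈ G → w ∈ C) : G ⊆ C := by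
  have hG' := hG.1
  rw [← hP.convexHull_vertices] at hG'
  exact (subset_convexHull_inter_of_isExtreme hG').trans
    (convexHull_min (fun w hw => h w hw.1 hw.2) hC)

theorem isFace_self {P : Set E} (hP : Convex ℝ P) : IsFace P P :=
  ⟨IsExtreme.refl ℝ P, hP⟩

theorem isFace_empty (P : Set E) : IsFace P ∅ :=
  ⟨⟨Set.empty_subset P, fun _ _ _ _ _ h => h.elim⟩, convex_empty⟩

theorem starFace_eq {P U : Set E} {Q : Set E'} (e : QuotientIso P U Q) (G : FacesAbove P U) :
    starFace e G = (e G : Set E') := by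
  ext z
  exact ⟨fun ⟨_, hz⟩ => hz, fun hz => ⟨G.2, hz⟩⟩

theorem starFace_subset_iff {P U : Set E} {Q Fs : Set E'} (e : QuotientIso P U Q)
    (hFs : IsFace Q Fs) {G : Set E} (hG : IsFace P G) (hUG : U ⊆ G) :
    starFace e G ⊆ Fs ↔ G ⊆ (e.symm ⟨Fs, hFs⟩ : Set E) := by
  rw [starFace_eq e ⟨G, hG, hUG⟩]
  exact (e.le_symm_apply (x := ⟨G, hG, hUG⟩) (y := ⟨Fs, hFs⟩)).symm

/-- Facets of the quotient correspond to facets of `P`. -/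
theorem isFacet_symm {P U : Set E} {Q Fs : Set E'} (e : QuotientIso P U Q)
    (hP : Convex ℝ P) (hQ : Convex ℝ Q) (hU : U ⊆ P) (h : IsFacet Q Fs) :
    IsFacet P (e.symm ⟨Fs, h.1⟩ : Set E) := by
  have htop : ∀ A : Faces Q, (e.symm A : Set E) = P → (A : Set E') = Q := by
    intro A hA
    refine (A.2.1.1).antisymm ?_
    have : (⟨Q, isFace_self hQ⟩ : Faces Q) ≤ A := by
      rw [← e.symm.le_iff_le]
      exact (e.symm ⟨Q, isFace_self hQ⟩).2.1.1.1.trans hA.ge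
    exact this
  refine ⟨(e.symm ⟨Fs, h.1⟩).2.1, fun hh => h.2.1 (htop _ hh), fun G hG hle hne => ?_⟩
  obtain ⟨A, hA⟩ := e.symm.surjective ⟨G, hG, (e.symm ⟨Fs, h.1⟩).2.2.trans hle⟩
  have hAG : (e.symm A : Set E) = G := congrArg Subtype.val hA
  have hFA : (⟨Fs, h.1⟩ : Faces Q) ≤ A := by
    rw [← e.symm.le_iff_le, hA]
    exact hle
  have hAQ : (A : Set E') ≠ Q := by
    rintro hq
    have hAtop : A = ⟨Q, isFace_self hQ⟩ := Subtype.ext hq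
    refine hne (hG.1.1.antisymm ?_)
    have : e ⟨P, isFace_self hP, hU⟩ ≤ A := by
      rw [hAtop]
      exact (e ⟨P, isFace_self hP, hU⟩).2.1.1
    rw [← e.symm.le_iff_le, e.symm_apply_apply, hA] at this
    exact this
  have hAF : A = ⟨Fs, h.1⟩ := Subtype.ext (h.2.2 A A.2 hFA hAQ)
  rw [← hAG, hAF]

/-- If `[U, w]` is a face of `P` for all vertices `w` of `P`, then the face of `P` over a face
`[v_1*, …, v_n*]` of `P / U` is `[U, v_1, …, v_n]`. -/
theorem symm_eq_convexHull {ι : Type*} {d : ℕ} {P U : Set E} {Q : Set E'}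
    (hP : IsPolytope d P) (hU : IsFace P U)
    (huniv : ∀ w ∈ vertices P, IsFace P (convexHull ℝ (U ∪ {w})))
    (e : QuotientIso P U Q) {v : ι → E} (hv : ∀ j, v j ∈ vertices P \ U) {vs : ι → E'}
    (hvs : ∀ j, starFace e (convexHull ℝ (U ∪ {v j})) = {vs j})
    (hFs : IsFace Q (convexHull ℝ (Set.range vs))) :
    (e.symm ⟨_, hFs⟩ : Set E) = convexHull ℝ (U ∪ Set.range v) := by
  have hUw : ∀ w, U ⊆ convexHull ℝ (U ∪ {w}) := fun w =>
    Set.subset_union_left.trans (subset_convexHull ℝ _)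
  have hw_mem : ∀ w, w ∈ convexHull ℝ (U ∪ {w}) := fun w =>
    subset_convexHull ℝ _ (Or.inr rfl)
  apply Set.Subset.antisymm
  · refine IsFace.subset_of_vertices hP (e.symm ⟨_, hFs⟩).2.1 (convex_convexHull ℝ _) ?_
    intro w hw hwG
    by_cases hwU : w ∈ U
    · exact subset_convexHull ℝ _ (Or.inl hwU)
    let W : FacesAbove P U := ⟨convexHull ℝ (U ∪ {w}), huniv w hw, hUw w⟩
    have hWG : (e W : Set E') ⊆ convexHull ℝ (Set.range vs) := by
      rw [← starFace_eq, starFace_subset_iff e hFs W.2.1 W.2.2]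
      exact convexHull_min (Set.union_subset (e.symm ⟨_, hFs⟩).2.2
        (Set.singleton_subset_iff.2 hwG)) (e.symm ⟨_, hFs⟩).2.1.2
    have hne : (e W : Set E').Nonempty := by
      rw [Set.nonempty_iff_ne_empty]
      intro h0
      have : e W ≤ e ⟨U, hU, subset_rfl⟩ := by
        change (e W : Set E') ⊆ _
        rw [h0]
        exact Set.empty_subset _
      exact hwU (e.le_iff_le.1 this (hw_mem w))
    -- A nonempty face of `[v_1*, …, v_n*]` contains some `v_j*`. Pulled back, this puts `v j` in
    -- `[U, w]`; being a vertex of `P` outside `U`, it must equal `w`.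
    have hext : IsExtreme ℝ (convexHull ℝ (Set.range vs)) (e W : Set E') :=
      (e W).2.1.mono hFs.1.1 hWG
    obtain ⟨z, hz⟩ := hne
    obtain ⟨_, ⟨j, rfl⟩, hj⟩ : (Set.range vs ∩ (e W : Set E')).Nonempty :=
      convexHull_nonempty_iff.1 ⟨z, subset_convexHull_inter_of_isExtreme hext hz⟩
    have hle : convexHull ℝ (U ∪ {v j}) ⊆ (W : Set E) := by
      have := (starFace_subset_iff e (e W).2 (huniv _ (hv j).1) (hUw (v j))).1
        (by rw [hvs j]; exact Set.singleton_subset_iff.2 hj)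
      rwa [Subtype.coe_eta, e.symm_apply_apply] at this
    have hvW : v j ∈ (convexHull ℝ (U ∪ {w})).extremePoints ℝ :=
      inter_extremePoints_subset_extremePoints_of_subset W.2.1.1.1 ⟨hle (hw_mem _), (hv j).1⟩
    rcases extremePoints_convexHull_subset hvW with h | h
    · exact absurd h (hv j).2
    · exact subset_convexHull ℝ _ (Or.inr ⟨j, h⟩)
  · refine convexHull_min (Set.union_subset (e.symm ⟨_, hFs⟩).2.2 ?_) (e.symm ⟨_, hFs⟩).2.1.2
    rintro _ ⟨j, rfl⟩
    refine (starFace_subset_iff e hFs (huniv _ (hv j).1) (hUw _)).1 ?_ (hw_mem _)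
    rw [hvs j]
    exact Set.singleton_subset_iff.2 (subset_convexHull ℝ _ ⟨j, rfl⟩)

/-- Covers `i = m`, where the quotient is a point and its facet is the empty face. -/
theorem symm_empty_eq {P U : Set E} {Q : Set E'} (hU : IsFace P U) (e : QuotientIso P U Q) :
    (e.symm ⟨∅, isFace_empty Q⟩ : Set E) = U := by
  refine Set.Subset.antisymm ?_ (e.symm _).2.2
  have : (⟨∅, isFace_empty Q⟩ : Faces Q) ≤ e ⟨U, hU, subset_rfl⟩ := Set.empty_subset _
  rw [← e.symm.le_iff_le, e.symm_apply_apply] at this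
  exact this

theorem tower_mono (x y : ℕ → E) : Monotone (tower x y) :=
  monotone_nat_of_le_succ fun _ => Set.subset_union_left.trans (subset_convexHull ℝ _)

/-- If the last member of the tower that lies in the facet `F` is the `J`-th, then `F` belongs to
`towerFacets` if and only if `J` is odd. -/
theorem mem_towerFacets_iff_odd {P F : Set E} {m J : ℕ} {T : ℕ → Set E} (hF : IsFacet P F)
    (hJ : ∀ j, (j ≤ m ∧ (j = 0 ∨ T j ⊆ F)) ↔ j ≤ J) : F ∈ towerFacets P m T ↔ Odd J := by
  simp only [towerFacets, facetsThrough, Set.mem_iUnion, Set.mem_sdiff, Set.mem_ofPred_eq, hJ, hF,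
    true_and]
  refine ⟨fun ⟨j, hj, h1, h2⟩ => ?_, fun h => ⟨J, h, le_rfl, by omega⟩⟩
  rwa [show J = j by omega]

theorem exists_last_tower_index {F : Set E} {m i : ℕ} {x y : ℕ → E} (hi : i ≤ m)
    (h : tower x y i ⊆ F) :
    ∃ J, i ≤ J ∧ ∀ j, (j ≤ m ∧ (j = 0 ∨ tower x y j ⊆ F)) ↔ j ≤ J := by
  classical
  have hspec := Nat.findGreatest_spec (P := fun j => tower x y j ⊆ F) hi h
  refine ⟨Nat.findGreatest (fun j => tower x y j ⊆ F) m, Nat.le_findGreatest hi h, fun j => ?_⟩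
  constructor
  · rintro ⟨hj, rfl | hjF⟩
    · exact Nat.zero_le _
    · exact Nat.le_findGreatest hj hjF
  · exact fun hj => ⟨hj.trans (Nat.findGreatest_le m), Or.inr ((tower_mono x y hj).trans hspec)⟩

/-- Beyond and beneath exclude each other, so both implications in `ExactlyBeyond` reverse. -/
theorem ExactlyBeyond.beyond_iff {P F : Set E} {C : Set (Set E)} {z : E}
    (h : ExactlyBeyond P C z) (hF : IsFacet P F) : Beyond P F z ↔ F ∈ C :=
  ⟨fun hb => by_contra fun hC => ((h F hF).2 hC).2 hb.2, (h F hF).1⟩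

theorem ExactlyBeyond.beneath_iff {P F : Set E} {C : Set (Set E)} {z : E}
    (h : ExactlyBeyond P C z) (hF : IsFacet P F) : Beneath P F z ↔ F ∉ C :=
  ⟨fun hb hC => hb.2 ((h F hF).1 hC).2, (h F hF).2⟩

end Sewing

theorem proposition3p2 {E E' : Type*}
    [NormedAddCommGroup E] [NormedSpace ℝ E] [FiniteDimensional ℝ E]
    [NormedAddCommGroup E'] [NormedSpace ℝ E'] [FiniteDimensional ℝ E']
    -- the neighbourly `2m`-polytope `P`, the universal tower, and the point sewn onto `P`
    (m : ℕ) (hm : 1 < m) (P : Set E) (hP : IsNeighbourly (2 * m) P)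
    (hcard : 2 * m + 3 ≤ (vertices P).ncard)
    (x y : ℕ → E) (hT : IsUniversalTower m P x y)
    (xbar : E) (hxbar : ExactlyBeyond P (towerFacets P m (tower x y)) xbar)
    -- the quotient polytope `Q = P / Φ_i`
    (i : ℕ) (hi : 1 ≤ i) (him : i ≤ m)
    (Q : Set E') (hQ : IsPolytope (2 * m - 2 * i) Q) (e : QuotientIso P (tower x y i) Q)
    -- the point sewn onto `Q` through the tower `Φ_{i+1}*, …, Φ_m*`
    (ybar : E')
    (hybar : ExactlyBeyond Q
      (towerFacets Q (m - i) (fun n => starFace e (tower x y (i + n)))) ybar)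
    -- the facet `F* = [v_1*, …, v_{2m-2i}*]` of `Q`
    (v : Fin (2 * m - 2 * i) → E) (hv : ∀ j, v j ∈ vertices P \ tower x y i)
    (vs : Fin (2 * m - 2 * i) → E')
    (hvs : ∀ j, starFace e (convexHull ℝ (tower x y i ∪ {v j})) = {vs j})
    (F : Set E) (hF : F = convexHull ℝ (Set.range v))
    (Fs : Set E') (hFs : Fs = convexHull ℝ (Set.range vs)) (hfacet : IsFacet Q Fs) :
    IsFacet P (convexHull ℝ (tower x y i ∪ F)) ∧
    (Beneath Q Fs ybar ↔
      (Beneath P (convexHull ℝ (tower x y i ∪ F)) xbar ∧ Even i) ∨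
      (Beyond P (convexHull ℝ (tower x y i ∪ F)) xbar ∧ Odd i)) ∧
    (Beyond Q Fs ybar ↔
      (Beyond P (convexHull ℝ (tower x y i ∪ F)) xbar ∧ Even i) ∨
      (Beneath P (convexHull ℝ (tower x y i ∪ F)) xbar ∧ Odd i)) := by
  subst hF hFs
  have hPoly := hP.1
  have hUi := hT.universal i ⟨hi, him⟩
  have hG : (e.symm ⟨_, hfacet.1⟩ : Set E) =
      convexHull ℝ (tower x y i ∪ Set.range v) := by
    rcases him.eq_or_lt with rfl | hlt
    · have : IsEmpty (Fin (2 * i - 2 * i)) := by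
        rw [Nat.sub_self]
        infer_instance
      simp only [Set.range_eq_empty, convexHull_empty, Set.union_empty]
      rw [symm_empty_eq hUi.isFace e, hUi.isFace.2.convexHull_eq]
    · refine symm_eq_convexHull hPoly hUi.isFace (fun w hw => ?_) e hv hvs hfacet.1
      -- The bound `(2m - (2i - 1) - 1) / 2` equals `m - i`, which admits one vertex because `i <
      -- m`.
      have := hUi.universal {w} (by simpa using hw) (by rw [Finset.card_singleton]; omega)
      rwa [Finset.coe_singleton, Set.union_comm] at this
  have hFacet := isFacet_symm e hPoly.convex hQ.convex hUi.isFace.1.1 hfacet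
  have hsub := (e.symm ⟨_, hfacet.1⟩).2.2
  have hstar : ∀ n, 1 ≤ n → i + n ≤ m →
      (starFace e (tower x y (i + n)) ⊆ convexHull ℝ (Set.range vs) ↔
        tower x y (i + n) ⊆ convexHull ℝ (tower x y i ∪ convexHull ℝ (Set.range v))) := by
    intro n hn hnm
    rw [starFace_subset_iff e hfacet.1 (hT.universal (i + n) ⟨by omega, hnm⟩).isFace
      (tower_mono x y (Nat.le_add_right i n)), hG, convexHull_convexHull_union_right]
  rw [hG, ← convexHull_convexHull_union_right] at hFacet hsub
  obtain ⟨J, hiJ, hJ⟩ := exists_last_tower_index him hsub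
  -- The last index in the quotient tower is `J - i`, a true difference since `i ≤ J`. For `n = 0`
  -- the convention replaces the containment.
  have hJ' : ∀ n, (n ≤ m - i ∧ (n = 0 ∨
      starFace e (tower x y (i + n)) ⊆ convexHull ℝ (Set.range vs))) ↔ n ≤ J - i := by
    intro n
    rcases Nat.eq_zero_or_pos n with rfl | hn
    · simp
    · have h1 := hJ (i + n)
      have h2 := hstar n hn
      constructor
      · rintro ⟨hnm, h | h⟩
        · omega
        · have := h1.1 ⟨by omega, Or.inr ((h2 (by omega)).1 h)⟩
          omega
      · intro h
        obtain ⟨h3, h4⟩ := h1.2 (by omega)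
        exact ⟨by omega, Or.inr ((h2 h3).2 (h4.resolve_left (by omega)))⟩
  rw [hybar.beneath_iff hfacet, hybar.beyond_iff hfacet, hxbar.beneath_iff hFacet,
    hxbar.beyond_iff hFacet, mem_towerFacets_iff_odd hfacet hJ', mem_towerFacets_iff_odd hFacet hJ]
  refine ⟨hFacet, ?_, ?_⟩ <;> grind
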